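/- Let $k$ be a field, $n\ge 2$, and $A=k[x_1,\dots,x_n]$. For $\alpha\in\mathbb Z^n$ write $\alpha=\alpha_+-\alpha_-$ with $\alpha_+=\max(\alpha,0)$ and $\alpha_-=-\min(\alpha,0)$ taken entrywise. For an $n\times s$ integer matrix $M$ let $I(M)\subseteq A$ be the ideal generated by the binomials $x^{\alpha_+}-x^{\alpha_-}$, where $\alpha$ runs over the columns of $M$; let $\mathcal M\subseteq\mathbb Z^n$ be the subgroup spanned by the columns of $M$; and let $I(\mathcal M)=(x^{\alpha_+}-x^{\alpha_-}\mid \alpha\in\mathcal M)$ be its lattice ideal. Let $\mathfrak A$ be the class of ideals $I(M)$ of $A$, where $M$ is an $n\times r$ integer matrix of rank $r$, $r\le n$, such that $\mathcal M\cap\mathbb N_0^n=\{0\}$ and the lattice ideal $I(\mathcal M)$ is prime. Let $\mathfrak B$ be the class of PCB (positive critical binomial) ideals of $A$, that is, the ideals $I(L)$, where $L$ is an $n\times n$ integer matrix with positive diagonal entries, negative off-diagonal entries and all row sums equal to zero. (a) If $n>2$, then $\mathfrak A\cap\mathfrak B=\emptyset$. (b) If $n=2$, then $\mathfrak A\cap\mathfrak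 B$ is exactly the class of principal ideals of $A$ generated by an irreducible binomial of the form $x_1^a-x_2^b$ with integers $a,b\ge 1$. Moreover, for integers $a,b\ge1$, the binomial $x_1^a-x_2^b$ is irreducible in $A$ if and only if $\gcd(a,b)=1$. -/

import Mathlib

namespace PCB

open MvPolynomial

/-- The exponent vector `α₊ = max(α, 0)` of an integer vector `α`, with entries in the
nonnegative integers. Note that `plusExponent (-α)` is `α₋ = -min(α, 0)`. -/
noncomputable def plusExponent {n : ℕ} (α : Fin n → ℤ) : Fin n →₀ ℕ :=
  Finsupp.equivFunOnFinite.symm fun i => (α i).toNat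

/-- The binomial `x^{α₊} - x^{α₋}` of `k[x₁, …, xₙ]`. -/
noncomputable def binomial (k : Type*) [Field k] {n : ℕ} (α : Fin n → ℤ) :
    MvPolynomial (Fin n) k :=
  monomial (plusExponent α) 1 - monomial (plusExponent (-α)) 1

/-- The binomial ideal `I(M)` generated by the binomials of the columns of the integer
matrix `M`. -/
noncomputable def matrixIdeal (k : Type*) [Field k] {n s : ℕ}
    (M : Matrix (Fin n) (Fin s) ℤ) : Ideal (MvPolynomial (Fin n) k) :=
  Ideal.span (Set.range fun j : Fin s => binomial k fun i => M i j)

/-- The lattice (subgroup of `ℤⁿ`) spanned by the columns of `M`. -/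
def columnLattice {n s : ℕ} (M : Matrix (Fin n) (Fin s) ℤ) : AddSubgroup (Fin n → ℤ) :=
  AddSubgroup.closure (Set.range fun j : Fin s => fun i => M i j)

/-- The lattice ideal of a subgroup of `ℤⁿ`: it is generated by the binomials
`x^{α₊} - x^{α₋}` of all the elements `α` of the subgroup. -/
noncomputable def latticeIdeal (k : Type*) [Field k] {n : ℕ}
    (Λ : AddSubgroup (Fin n → ℤ)) : Ideal (MvPolynomial (Fin n) k) :=
  Ideal.span {f | ∃ α ∈ Λ, f = binomial k α}

/-- Positive critical binomial matrices: positive diagonal entries `a_{i,i}`, negative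
off-diagonal entries `-a_{i,j}`, and `a_{i,i} = ∑_{j ≠ i} a_{i,j}`, i.e. zero row sums. -/
structure IsPCBMatrix {n : ℕ} (L : Matrix (Fin n) (Fin n) ℤ) : Prop where
  diag_pos : ∀ i, 0 < L i i
  offDiag_neg : ∀ i j, i ≠ j → L i j < 0
  row_sum : ∀ i, ∑ j, L i j = 0

/-- The class of PCB ideals of `k[x₁, …, xₙ]`. -/
def pcbIdeals (k : Type*) [Field k] (n : ℕ) : Set (Ideal (MvPolynomial (Fin n) k)) :=
  {J | ∃ L : Matrix (Fin n) (Fin n) ℤ, IsPCBMatrix L ∧ J = matrixIdeal k L}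

/-- The class of Hoşten–Shapiro ideals of `k[x₁, …, xₙ]`: the ideals `I(M)`, for `M` an
`n × r` integer matrix of rank `r ≤ n`, whose column lattice meets `ℕ₀ⁿ` only in `0` and has
a prime lattice ideal. -/
def hostenShapiroIdeals (k : Type*) [Field k] (n : ℕ) :
    Set (Ideal (MvPolynomial (Fin n) k)) :=
  {J | ∃ (r : ℕ) (M : Matrix (Fin n) (Fin r) ℤ),
    r ≤ n ∧
    (M.map (Int.cast : ℤ → ℚ)).rank = r ∧
    (∀ α ∈ columnLattice M, (∀ i, 0 ≤ α i) → α = 0) ∧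
    (latticeIdeal k (columnLattice M)).IsPrime ∧
    J = matrixIdeal k M}

end PCB

namespace PCB

open MvPolynomial

/-! ### Case n > 2: counting generators -/

section General

variable {k : Type*} [Field k] {n : ℕ}

/-! For n > 2 the two classes are separated by the number of generators. An ideal in the first class
has fewer than n, since a lattice of full rank contains a positive multiple of (1, …, 1)
(`lt_of_rank_eq`). A PCB ideal needs n: restricting to the coordinate axes shows that syzygies of
its generators have no constant terms, so passing to r generators and back is the identity modulo
the variables, whence n ≤ r (`le_of_matrixIdeal_eq_span`). For n = 2 a PCB ideal is generated by one
x^a - y^b. A nonzero ideal of the first class has a single column ±(a, -b) and equals its lattice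
ideal, so primality of the latter is irreducibility of x^a - y^b. Coprimality enters through the
parametrization x ↦ t^b, y ↦ t^a (`ker_aeval_le`). -/

theorem binomial_eq_prod (α : Fin n → ℤ) :
    binomial k α = ∏ i, X i ^ (α i).toNat - ∏ i, X i ^ (-α i).toNat := by
  simp [binomial, plusExponent, monomial_eq, Finsupp.prod_fintype]

theorem binomial_neg (α : Fin n → ℤ) : binomial k (-α) = -binomial k α := by
  simp [binomial]

theorem aeval_binomial {R : Type*} [CommRing R] [Algebra k R] (e : Fin n → R) (α : Fin n → ℤ) :
    aeval e (binomial k α) = ∏ i, e i ^ (α i).toNat - ∏ i, e i ^ (-α i).toNat := by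
  simp [binomial_eq_prod]

theorem mem_columnLattice {s : ℕ} (M : Matrix (Fin n) (Fin s) ℤ) (v : Fin s → ℤ) :
    M.mulVec v ∈ columnLattice M := by
  rw [Matrix.mulVec_eq_sum]
  refine sum_mem fun j _ => ?_
  rw [op_smul_eq_smul]
  exact zsmul_mem (AddSubgroup.subset_closure (Set.mem_range_self j)) (v j)

/-- A lattice of full rank contains a positive multiple of `(1, …, 1)`. -/
theorem exists_pos_mem_columnLattice (M : Matrix (Fin n) (Fin n) ℤ)
    (hM : (M.map (Int.cast : ℤ → ℚ)).rank = n) :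
    ∃ d : ℤ, 0 < d ∧ (fun _ => d) ∈ columnLattice M := by
  have hdet : M.det ≠ 0 := by
    intro h0
    have hunit : IsUnit (M.map (Int.cast : ℤ → ℚ)) := by
      rw [← Matrix.linearIndependent_cols_iff_isUnit,
        linearIndependent_iff_card_eq_finrank_span, Set.finrank,
        ← Matrix.rank_eq_finrank_span_cols, hM]
      simp
    rw [Matrix.isUnit_iff_isUnit_det] at hunit
    have : (M.map (Int.cast : ℤ → ℚ)).det = ((M.det : ℤ) : ℚ) :=
      (RingHom.map_det (Int.castRingHom ℚ) M).symm
    rw [this, h0] at hunit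
    simp at hunit
  -- M · adj(M) · (1, …, 1) = det M · (1, …, 1) is an integer combination of the columns.
  have hmem : (fun _ => M.det) ∈ columnLattice M := by
    have h := mem_columnLattice M (M.adjugate.mulVec fun _ => 1)
    rw [Matrix.mulVec_mulVec, Matrix.mul_adjugate, Matrix.smul_mulVec, Matrix.one_mulVec] at h
    convert h using 1
    ext i
    simp
  rcases lt_or_gt_of_ne hdet with h | h
  · exact ⟨-M.det, by omega, neg_mem hmem⟩
  · exact ⟨M.det, h, hmem⟩

theorem lt_of_rank_eq {r : ℕ} (hn : 0 < n) (M : Matrix (Fin n) (Fin r) ℤ) (hr : r ≤ n)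
    (hM : (M.map (Int.cast : ℤ → ℚ)).rank = r)
    (hpos : ∀ α ∈ columnLattice M, (∀ i, 0 ≤ α i) → α = 0) : r < n := by
  refine lt_of_le_of_ne hr ?_
  rintro rfl
  obtain ⟨d, hd, hmem⟩ := exists_pos_mem_columnLattice M hM
  have := congrFun (hpos _ hmem fun _ => hd.le) ⟨0, hn⟩
  simp only [Pi.zero_apply] at this
  omega

/-- On the `j`-th coordinate axis all generators of a PCB ideal except the `j`-th vanish. -/
theorem aeval_single_binomial_of_ne (hn : 2 < n) {L : Matrix (Fin n) (Fin n) ℤ}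
    (hL : IsPCBMatrix L) {i j : Fin n} (hij : i ≠ j) :
    aeval (Pi.single j (Polynomial.X : Polynomial k)) (binomial k fun m => L m i) = 0 := by
  -- With a third index m, x_i divides the positive monomial and x_m the negative one; both
  -- variables vanish on axis j.
  obtain ⟨m, hm⟩ : ∃ m, m ∉ ({i, j} : Finset (Fin n)) := by
    by_contra! h
    have h1 := Finset.card_le_card (fun x _ => h x : (Finset.univ : Finset (Fin n)) ⊆ {i, j})
    have h2 := Finset.card_le_two (a := i) (b := j)
    simp only [Finset.card_univ, Fintype.card_fin] at h1
    omega
  simp only [Finset.mem_insert, Finset.mem_singleton, not_or] at hm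
  have h1 := hL.diag_pos i
  have h2 := hL.offDiag_neg m i hm.1
  rw [aeval_binomial, Finset.prod_eq_zero (Finset.mem_univ i),
    Finset.prod_eq_zero (Finset.mem_univ m), sub_zero]
  · rw [Pi.single_eq_of_ne hm.2, zero_pow]; omega
  · rw [Pi.single_eq_of_ne hij, zero_pow]; omega

theorem aeval_single_binomial_self (hn : 2 < n) {L : Matrix (Fin n) (Fin n) ℤ}
    (hL : IsPCBMatrix L) (j : Fin n) :
    aeval (Pi.single j (Polynomial.X : Polynomial k)) (binomial k fun m => L m j) =
      Polynomial.X ^ (L j j).toNat := by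
  have : Nontrivial (Fin n) := Fin.nontrivial_iff_two_le.2 hn.le
  obtain ⟨m, hm⟩ := exists_ne j
  have h2 := hL.offDiag_neg m j hm
  rw [aeval_binomial, Finset.prod_eq_single j,
    Finset.prod_eq_zero (Finset.mem_univ m), sub_zero]
  · simp
  · rw [Pi.single_eq_of_ne hm, zero_pow]; omega
  · intro i _ hi
    have := hL.offDiag_neg i j hi
    rw [show (L i j).toNat = 0 by omega, pow_zero]
  · simp

/-- The syzygies of the generators of a PCB ideal have no constant terms. -/
theorem constantCoeff_eq_zero_of_sum_eq_zero (hn : 2 < n) {L : Matrix (Fin n) (Fin n) ℤ}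
    (hL : IsPCBMatrix L) (h : Fin n → MvPolynomial (Fin n) k)
    (hs : ∑ i, h i * binomial k (fun m => L m i) = 0) (j : Fin n) :
    constantCoeff (h j) = 0 := by
  have h1 := congrArg (aeval (Pi.single j (Polynomial.X : Polynomial k))) hs
  rw [map_sum, map_zero, Finset.sum_eq_single j, map_mul, aeval_single_binomial_self hn hL] at h1
  · have h2 := (mul_eq_zero.1 h1).resolve_right (pow_ne_zero _ Polynomial.X_ne_zero)
    -- Setting t = 0 on the axis reaches the origin, where h_j takes the value of its constant term.
    have h3 := congrArg (Polynomial.aeval (0 : k)) h2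
    rw [← AlgHom.comp_apply, comp_aeval, map_zero] at h3
    have h4 : (fun i => Polynomial.aeval (0 : k)
        (Pi.single (M := fun _ => Polynomial k) j Polynomial.X i)) = fun _ => 0 := by
      ext i
      rcases eq_or_ne i j with rfl | hi
      · simp
      · simp [Pi.single_eq_of_ne hi]
    rw [h4] at h3
    simpa [aeval_zero'] using h3
  · intro i _ hi
    rw [map_mul, aeval_single_binomial_of_ne hn hL hi, mul_zero]
  · simp

theorem exists_matrix_of_mem_span {R : Type*} [CommRing R] {ι κ : Type*} [Fintype κ]
    (f : ι → R) (g : κ → R) (h : ∀ i, f i ∈ Ideal.span (Set.range g)) :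
    ∃ P : Matrix ι κ R, P.mulVec g = f := by
  choose P hP using fun i => (Ideal.mem_span_range_iff_exists_fun).1 (h i)
  exact ⟨P, funext hP⟩

/-- After applying φ, the identity of k^n factors through k^r. -/
theorem le_of_map_one_sub_mul_eq_zero {R : Type*} [CommRing R] (φ : R →+* k) {r : ℕ}
    (P : Matrix (Fin n) (Fin r) R) (Q : Matrix (Fin r) (Fin n) R)
    (h : ∀ i j, φ ((1 - P * Q : Matrix (Fin n) (Fin n) R) i j) = 0) : n ≤ r := by
  have h0 : φ.mapMatrix (1 - P * Q) = 0 := by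
    ext i j
    exact h i j
  have hone : P.map φ * Q.map φ = 1 := by
    rw [map_sub, map_one, sub_eq_zero] at h0
    rw [h0]
    exact Matrix.map_mul.symm
  have h1 := Matrix.rank_mul_le_left (P.map φ) (Q.map φ)
  rw [hone, Matrix.rank_one, Fintype.card_fin] at h1
  exact h1.trans (by simpa using (P.map φ).rank_le_card_width)

/-- For `n > 2`, a PCB ideal is not generated by fewer than `n` elements. -/
theorem le_of_matrixIdeal_eq_span (hn : 2 < n) {L : Matrix (Fin n) (Fin n) ℤ}
    (hL : IsPCBMatrix L) {r : ℕ} (g : Fin r → MvPolynomial (Fin n) k)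
    (h : matrixIdeal k L = Ideal.span (Set.range g)) : n ≤ r := by
  set f : Fin n → MvPolynomial (Fin n) k := fun j => binomial k fun i => L i j
  have hfg : ∀ i, f i ∈ Ideal.span (Set.range g) := fun i => by
    rw [← h]
    exact Ideal.subset_span ⟨i, rfl⟩
  have hgf : ∀ i, g i ∈ Ideal.span (Set.range f) := fun i => by
    change g i ∈ matrixIdeal k L
    rw [h]
    exact Ideal.subset_span ⟨i, rfl⟩
  obtain ⟨P, hP⟩ := exists_matrix_of_mem_span f g hfg
  obtain ⟨Q, hQ⟩ := exists_matrix_of_mem_span g f hgf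
  -- The rows of 1 - PQ are syzygies of f.
  have hPQ : (1 - P * Q : Matrix (Fin n) (Fin n) (MvPolynomial (Fin n) k)).mulVec f = 0 := by
    rw [Matrix.sub_mulVec, Matrix.one_mulVec, ← Matrix.mulVec_mulVec, hQ, hP, sub_self]
  refine le_of_map_one_sub_mul_eq_zero constantCoeff P Q fun i => ?_
  exact constantCoeff_eq_zero_of_sum_eq_zero hn hL _ (congrFun hPQ i)

theorem hostenShapiroIdeals_inter_pcbIdeals_eq_empty (hn : 2 < n) :
    hostenShapiroIdeals k n ∩ pcbIdeals k n = ∅ := by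
  rw [Set.eq_empty_iff_forall_notMem]
  rintro J ⟨⟨r, M, hr, hrank, hpos, -, hM⟩, L, hL, hJ⟩
  have h1 := lt_of_rank_eq (by omega) M hr hrank hpos
  have h2 := le_of_matrixIdeal_eq_span (k := k) hn hL (fun j => binomial k fun i => M i j)
    (hJ.symm.trans hM)
  omega

end General

/-! ### Case n = 2: principal ideals and coprime exponents -/

section TwoVariables

variable {k : Type*} [Field k]

theorem X_pow_sub_X_pow_ne_zero {a b : ℕ} (hb : 0 < b) :
    (X 0 ^ a - X 1 ^ b : MvPolynomial (Fin 2) k) ≠ 0 := by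
  intro h
  have := congrArg (eval ![1, 0]) h
  simp [hb.ne'] at this

theorem not_isUnit_X_pow_sub_X_pow {a b : ℕ} (ha : 0 < a) (hb : 0 < b) :
    ¬ IsUnit (X 0 ^ a - X 1 ^ b : MvPolynomial (Fin 2) k) := by
  intro h
  have := h.map (eval ![0, 0])
  simp [ha.ne', hb.ne'] at this

/-- Give x weight b and y weight a. By coprimality, exponents of equal weight differ by a multiple
of (a, -b), so x^a ≡ y^b identifies the monomials. -/
theorem monomial_sub_monomial_mem {a b : ℕ} (ha : 0 < a) (hab : a.gcd b = 1)
    {i j i' j' : ℕ} (h : b * i + a * j = b * i' + a * j') (hi : i ≤ i') :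
    (X 0 ^ i * X 1 ^ j - X 0 ^ i' * X 1 ^ j' : MvPolynomial (Fin 2) k) ∈
      Ideal.span {X 0 ^ a - X 1 ^ b} := by
  obtain ⟨u, rfl⟩ := Nat.exists_eq_add_of_le hi
  have hj : j' ≤ j := by nlinarith
  obtain ⟨v, rfl⟩ := Nat.exists_eq_add_of_le hj
  have huv : a * v = b * u := by nlinarith
  obtain ⟨t, rfl⟩ : a ∣ u := Nat.Coprime.dvd_of_dvd_mul_left hab ⟨v, huv.symm⟩
  obtain rfl : v = b * t := Nat.eq_of_mul_eq_mul_left ha (by rw [huv]; ring)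
  rw [Ideal.mem_span_singleton]
  have h1 := sub_dvd_pow_sub_pow (X 0 ^ a : MvPolynomial (Fin 2) k) (X 1 ^ b) t
  have h2 : (X 0 ^ i * X 1 ^ (j' + b * t) - X 0 ^ (i + a * t) * X 1 ^ j' :
      MvPolynomial (Fin 2) k) =
      ((X 0 ^ a) ^ t - (X 1 ^ b) ^ t) * (-(X 0 ^ i * X 1 ^ j')) := by
    rw [← pow_mul, ← pow_mul]; ring
  rw [h2]
  exact h1.mul_right _

theorem monomial_fin_two (s : Fin 2 →₀ ℕ) :
    (monomial s 1 : MvPolynomial (Fin 2) k) = X 0 ^ s 0 * X 1 ^ s 1 := by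
  simp [monomial_eq, Finsupp.prod_fintype]

/-- For coprime `a` and `b`, the ideal of `x^a - y^b` contains the kernel of the parametrization
`x ↦ t^b`, `y ↦ t^a`. -/
theorem ker_aeval_le {a b : ℕ} (ha : 0 < a) (hab : a.gcd b = 1) :
    RingHom.ker (aeval ![Polynomial.X ^ b, Polynomial.X ^ a] :
      MvPolynomial (Fin 2) k →ₐ[k] Polynomial k) ≤ Ideal.span {X 0 ^ a - X 1 ^ b} := by
  classical
  set J : Ideal (MvPolynomial (Fin 2) k) := Ideal.span {X 0 ^ a - X 1 ^ b}
  set φ : MvPolynomial (Fin 2) k →ₐ[k] Polynomial k :=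
    aeval ![Polynomial.X ^ b, Polynomial.X ^ a] with hφ
  -- `c m` is the class of any monomial of weight m; the value 0 at other m is never used.
  let c : ℕ → MvPolynomial (Fin 2) k ⧸ J := fun m =>
    if h : ∃ p : ℕ × ℕ, b * p.1 + a * p.2 = m then
      Ideal.Quotient.mk J (X 0 ^ h.choose.1 * X 1 ^ h.choose.2) else 0
  have hc : ∀ i j, c (b * i + a * j) = Ideal.Quotient.mk J (X 0 ^ i * X 1 ^ j) := by
    intro i j
    have h : ∃ p : ℕ × ℕ, b * p.1 + a * p.2 = b * i + a * j := ⟨(i, j), rfl⟩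
    simp only [c, dif_pos h]
    rcases le_total h.choose.1 i with h' | h'
    · exact Ideal.Quotient.eq.2 (monomial_sub_monomial_mem ha hab h.choose_spec h')
    · exact (Ideal.Quotient.eq.2 (monomial_sub_monomial_mem ha hab h.choose_spec.symm h')).symm
  let s : Polynomial k →ₗ[k] MvPolynomial (Fin 2) k ⧸ J :=
    (Polynomial.basisMonomials k).constr k c
  have hs : ∀ m, s (Polynomial.X ^ m) = c m := by
    intro m
    have := (Polynomial.basisMonomials k).constr_basis k c m
    simpa only [Polynomial.coe_basisMonomials, Polynomial.monomial_one_right_eq_X_pow] using this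
  -- The quotient map by J factors through φ, so it kills ker φ.
  have hcomp : s ∘ₗ φ.toLinearMap = (Ideal.Quotient.mkₐ k J).toLinearMap := by
    refine (basisMonomials (Fin 2) k).ext fun p => ?_
    have : φ (monomial p 1) = Polynomial.X ^ (b * p 0 + a * p 1) := by
      simp [monomial_fin_two, hφ, pow_add, pow_mul]
    simp only [coe_basisMonomials, LinearMap.comp_apply, AlgHom.toLinearMap_apply, this, hs, hc]
    rw [monomial_fin_two]
    rfl
  intro f hf
  have h1 := LinearMap.congr_fun hcomp f
  have h2 : φ f = 0 := hf
  simp only [LinearMap.comp_apply, AlgHom.toLinearMap_apply, h2, map_zero] at h1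
  exact Ideal.Quotient.eq_zero_iff_mem.1 h1.symm

theorem irreducible_of_gcd_eq_one {a b : ℕ} (ha : 0 < a) (hb : 0 < b) (hab : a.gcd b = 1) :
    Irreducible (X 0 ^ a - X 1 ^ b : MvPolynomial (Fin 2) k) := by
  have hker : Ideal.span {(X 0 ^ a - X 1 ^ b : MvPolynomial (Fin 2) k)} =
      RingHom.ker (aeval ![Polynomial.X ^ b, Polynomial.X ^ a] :
        MvPolynomial (Fin 2) k →ₐ[k] Polynomial k) := by
    refine le_antisymm ?_ (ker_aeval_le ha hab)
    rw [Ideal.span_singleton_le_iff_mem, RingHom.mem_ker]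
    simp [← pow_mul, mul_comm]
  refine Prime.irreducible ?_
  rw [← Ideal.span_singleton_prime (X_pow_sub_X_pow_ne_zero hb), hker]
  exact RingHom.ker_isPrime _

theorem gcd_eq_one_of_irreducible {a b : ℕ} (ha : 0 < a) (hb : 0 < b)
    (h : Irreducible (X 0 ^ a - X 1 ^ b : MvPolynomial (Fin 2) k)) : a.gcd b = 1 := by
  obtain ⟨a', ha'⟩ := Nat.gcd_dvd_left a b
  obtain ⟨b', hb'⟩ := Nat.gcd_dvd_right a b
  have hd := Nat.gcd_pos_of_pos_left b ha
  generalize a.gcd b = d at *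
  subst ha' hb'
  have ha1 := Nat.pos_of_mul_pos_left ha
  have hb1 := Nat.pos_of_mul_pos_left hb
  obtain ⟨q, hq⟩ := sub_dvd_pow_sub_pow (X 0 ^ a' : MvPolynomial (Fin 2) k) (X 1 ^ b') d
  rw [← pow_mul, ← pow_mul, mul_comm a', mul_comm b'] at hq
  have hunit : IsUnit q :=
    (h.isUnit_or_isUnit hq).resolve_left (not_isUnit_X_pow_sub_X_pow ha1 hb1)
  obtain ⟨u, hu, hqu⟩ := isUnit_iff_eq_C_of_isReduced.1 hunit
  -- Setting y = 0 with a constant cofactor u leaves t^(d a') = u t^a', which forces d = 1.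
  have h1 := congrArg (aeval (![Polynomial.X, 0] : Fin 2 → Polynomial k)) hq
  have h2 : (Polynomial.X ^ (d * a') : Polynomial k) = Polynomial.X ^ a' * Polynomial.C u := by
    simpa [hqu, ha.ne', hb.ne', hb1.ne', aeval_C, Polynomial.algebraMap_eq,
      hd.ne'] using h1
  have h3 := congrArg Polynomial.natDegree h2
  rw [Polynomial.natDegree_X_pow, mul_comm (Polynomial.X ^ a'),
    Polynomial.natDegree_C_mul_X_pow _ _ hu.ne_zero] at h3
  exact Nat.eq_of_mul_eq_mul_right ha1 (by omega)

theorem binomial_fin_two (a b : ℕ) :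
    binomial k ![(a : ℤ), -(b : ℤ)] = X 0 ^ a - X 1 ^ b := by
  simp [binomial_eq_prod]

theorem matrixIdeal_single_column (M : Matrix (Fin 2) (Fin 1) ℤ) :
    matrixIdeal k M = Ideal.span {binomial k fun i => M i 0} := by
  rw [matrixIdeal, Set.range_unique]
  rfl

theorem columnLattice_single_column (M : Matrix (Fin 2) (Fin 1) ℤ) :
    columnLattice M = AddSubgroup.zmultiples fun i => M i 0 := by
  rw [columnLattice, Set.range_unique, AddSubgroup.zmultiples_eq_closure]
  rfl

/-- The lattice ideal of the multiples of `(a, -b)` is principal. -/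
theorem latticeIdeal_zmultiples (a b : ℕ) :
    latticeIdeal k (AddSubgroup.zmultiples ![(a : ℤ), -(b : ℤ)]) =
      Ideal.span {X 0 ^ a - X 1 ^ b} := by
  have hnat : ∀ t : ℕ, binomial k ((t : ℤ) • ![(a : ℤ), -(b : ℤ)]) ∈
      Ideal.span {(X 0 ^ a - X 1 ^ b : MvPolynomial (Fin 2) k)} := by
    intro t
    have h : (t : ℤ) • ![(a : ℤ), -(b : ℤ)] = ![((a * t : ℕ) : ℤ), -((b * t : ℕ) : ℤ)] := by
      ext i
      fin_cases i <;> simp [mul_comm]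
    rw [h, binomial_fin_two, Ideal.mem_span_singleton, pow_mul, pow_mul]
    exact sub_dvd_pow_sub_pow _ _ _
  refine le_antisymm (Ideal.span_le.2 ?_) ((Ideal.span_singleton_le_iff_mem _).2 ?_)
  · rintro _ ⟨α, hα, rfl⟩
    obtain ⟨t, rfl⟩ := AddSubgroup.mem_zmultiples_iff.1 hα
    obtain ⟨m, rfl | rfl⟩ := t.eq_nat_or_neg
    · exact hnat m
    · rw [neg_smul, binomial_neg]
      exact neg_mem (hnat m)
  · exact Ideal.subset_span ⟨_, AddSubgroup.mem_zmultiples _, (binomial_fin_two a b).symm⟩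

/-- A nonzero vector of `ℤ²` such that neither it nor its negative is nonnegative is, up to sign,
of the form `(a, -b)` with `a` and `b` positive. -/
theorem exists_eq_of_forall_zmultiples (α : Fin 2 → ℤ) (h0 : α ≠ 0)
    (hpos : ∀ β ∈ AddSubgroup.zmultiples α, (∀ i, 0 ≤ β i) → β = 0) :
    ∃ a b : ℕ, 0 < a ∧ 0 < b ∧ (α = ![(a : ℤ), -(b : ℤ)] ∨ α = -![(a : ℤ), -(b : ℤ)]) := by
  have h1 : ¬ (0 ≤ α 0 ∧ 0 ≤ α 1) := fun h =>
    h0 (hpos α (AddSubgroup.mem_zmultiples α) (Fin.forall_fin_two.2 h))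
  have h2 : ¬ (0 ≤ -α 0 ∧ 0 ≤ -α 1) := fun h =>
    h0 (neg_eq_zero.1 (hpos (-α) (neg_mem (AddSubgroup.mem_zmultiples α))
      (Fin.forall_fin_two.2 h)))
  refine ⟨(α 0).natAbs, (α 1).natAbs, by omega, by omega, ?_⟩
  rcases lt_or_ge 0 (α 0) with h | h
  · refine Or.inl (funext (Fin.forall_fin_two.2 ⟨?_, ?_⟩))
    · change α 0 = ((α 0).natAbs : ℤ)
      omega
    · change α 1 = -((α 1).natAbs : ℤ)
      omega
  · refine Or.inr (funext (Fin.forall_fin_two.2 ⟨?_, ?_⟩))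
    · change α 0 = -((α 0).natAbs : ℤ)
      omega
    · change α 1 = -(-((α 1).natAbs : ℤ))
      omega

theorem matrixIdeal_pcb_fin_two {L : Matrix (Fin 2) (Fin 2) ℤ} (hL : IsPCBMatrix L) :
    ∃ a b : ℕ, 0 < a ∧ 0 < b ∧ matrixIdeal k L = Ideal.span {X 0 ^ a - X 1 ^ b} := by
  have h0 := hL.diag_pos 0
  have h1 := hL.diag_pos 1
  have r0 := hL.row_sum 0
  have r1 := hL.row_sum 1
  rw [Fin.sum_univ_two] at r0 r1
  -- Zero row sums make the rows (p, -p) and (-q, q), so the two columns are opposite.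
  have c0 : (fun i => L i 0) = ![((L 0 0).toNat : ℤ), -((L 1 1).toNat : ℤ)] := by
    ext i
    fin_cases i <;> simp <;> omega
  have c1 : (fun i => L i 1) = -![((L 0 0).toNat : ℤ), -((L 1 1).toNat : ℤ)] := by
    ext i
    fin_cases i <;> simp <;> omega
  refine ⟨(L 0 0).toNat, (L 1 1).toNat, by omega, by omega, ?_⟩
  refine le_antisymm (Ideal.span_le.2 ?_) ((Ideal.span_singleton_le_iff_mem _).2 ?_)
  · rintro _ ⟨j, rfl⟩
    fin_cases j
    · simp only [Fin.zero_eta, c0, binomial_fin_two]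
      exact Ideal.mem_span_singleton_self _
    · simp only [Fin.mk_one, c1, binomial_neg, binomial_fin_two]
      exact neg_mem (Ideal.mem_span_singleton_self _)
  · exact Ideal.subset_span ⟨0, by simp only [c0, binomial_fin_two]⟩

theorem span_mem_pcbIdeals {a b : ℕ} (ha : 0 < a) (hb : 0 < b) :
    Ideal.span {(X 0 ^ a - X 1 ^ b : MvPolynomial (Fin 2) k)} ∈ pcbIdeals k 2 := by
  have c0 : (fun i => !![(a : ℤ), -a; -b, b] i 0) = ![(a : ℤ), -(b : ℤ)] := by
    ext i
    fin_cases i <;> simp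
  have c1 : (fun i => !![(a : ℤ), -a; -b, b] i 1) = -![(a : ℤ), -(b : ℤ)] := by
    ext i
    fin_cases i <;> simp
  refine ⟨!![a, -a; -b, b], ⟨?_, ?_, ?_⟩, ?_⟩
  · intro i
    fin_cases i <;> simpa
  · intro i j hij
    fin_cases i <;> fin_cases j <;> simp_all
  · intro i
    fin_cases i <;> simp
  · refine le_antisymm ((Ideal.span_singleton_le_iff_mem _).2 ?_) (Ideal.span_le.2 ?_)
    · exact Ideal.subset_span ⟨0, by simp only [c0, binomial_fin_two]⟩
    · rintro _ ⟨j, rfl⟩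
      fin_cases j
      · simp only [Fin.zero_eta, c0, binomial_fin_two]
        exact Ideal.mem_span_singleton_self _
      · simp only [Fin.mk_one, c1, binomial_neg, binomial_fin_two]
        exact neg_mem (Ideal.mem_span_singleton_self _)

theorem span_mem_hostenShapiroIdeals {a b : ℕ} (ha : 0 < a) (hb : 0 < b)
    (h : Irreducible (X 0 ^ a - X 1 ^ b : MvPolynomial (Fin 2) k)) :
    Ideal.span {(X 0 ^ a - X 1 ^ b : MvPolynomial (Fin 2) k)} ∈ hostenShapiroIdeals k 2 := by
  have c0 : (fun i => !![(a : ℤ); -b] i 0) = ![(a : ℤ), -(b : ℤ)] := by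
    ext i
    fin_cases i <;> simp
  refine ⟨1, !![a; -b], by norm_num, ?_, ?_, ?_, ?_⟩
  · have hli : LinearIndependent ℚ ((!![(a : ℤ); -b] : Matrix (Fin 2) (Fin 1) ℤ).map
        (Int.cast : ℤ → ℚ)).col := by
      rw [linearIndependent_unique_iff]
      intro h0
      have := congrFun h0 0
      simp [Matrix.col] at this
      omega
    rw [Matrix.rank_eq_finrank_span_cols, finrank_span_eq_card hli, Fintype.card_fin]
  · intro α hα hα0
    rw [columnLattice_single_column, c0] at hα
    obtain ⟨t, rfl⟩ := AddSubgroup.mem_zmultiples_iff.1 hα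
    have h0 := hα0 0
    have h1 := hα0 1
    simp at h0 h1
    have ht : t = 0 := by
      have ha' : (0 : ℤ) < a := by exact_mod_cast ha
      have hb' : (0 : ℤ) < b := by exact_mod_cast hb
      exact le_antisymm (by nlinarith) (by nlinarith)
    rw [ht, zero_smul]
  · rw [columnLattice_single_column, c0, latticeIdeal_zmultiples,
      Ideal.span_singleton_prime h.ne_zero]
    exact h.prime
  · rw [matrixIdeal_single_column, c0, binomial_fin_two]

theorem exists_irreducible_of_mem_inter {J : Ideal (MvPolynomial (Fin 2) k)}
    (hA : J ∈ hostenShapiroIdeals k 2) (hB : J ∈ pcbIdeals k 2) :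
    ∃ a b : ℕ, 0 < a ∧ 0 < b ∧
      Irreducible (X 0 ^ a - X 1 ^ b : MvPolynomial (Fin 2) k) ∧
      J = Ideal.span {X 0 ^ a - X 1 ^ b} := by
  obtain ⟨r, M, hr, hrank, hpos, hprime, hM⟩ := hA
  obtain ⟨L, hL, hJ⟩ := hB
  have hne : J ≠ ⊥ := by
    obtain ⟨a, b, -, hb, h⟩ := matrixIdeal_pcb_fin_two (k := k) hL
    rw [hJ, h, Ne, Ideal.span_singleton_eq_bot]
    exact X_pow_sub_X_pow_ne_zero hb
  have hr2 := lt_of_rank_eq (by norm_num) M hr hrank hpos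
  interval_cases r
  -- No columns would give the zero ideal, but a PCB ideal is nonzero.
  · exact absurd (by rw [hM, matrixIdeal, Set.range_eq_empty, Ideal.span_empty]) hne
  · rw [columnLattice_single_column] at hpos hprime
    rw [matrixIdeal_single_column] at hM
    have h0 : (fun i => M i 0) ≠ 0 := by
      intro h
      rw [h] at hM
      exact hne (by simpa [binomial] using hM)
    obtain ⟨a, b, ha, hb, h⟩ := exists_eq_of_forall_zmultiples _ h0 hpos
    have hz : AddSubgroup.zmultiples (fun i => M i 0) =
        AddSubgroup.zmultiples ![(a : ℤ), -(b : ℤ)] := by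
      rcases h with h | h <;> rw [h]
      exact AddSubgroup.zmultiples_neg
    have hI : J = Ideal.span {X 0 ^ a - X 1 ^ b} := by
      rcases h with h | h <;> rw [hM, h]
      · rw [binomial_fin_two]
      · rw [binomial_neg, binomial_fin_two, Ideal.span_singleton_neg]
    rw [hz, latticeIdeal_zmultiples,
      Ideal.span_singleton_prime (X_pow_sub_X_pow_ne_zero hb)] at hprime
    exact ⟨a, b, ha, hb, hprime.irreducible, hI⟩

end TwoVariables

end PCB

theorem proposition5p9 (k : Type*) [Field k] :
    (∀ n : ℕ, 2 < n → PCB.hostenShapiroIdeals k n ∩ PCB.pcbIdeals k n = ∅) ∧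
    (PCB.hostenShapiroIdeals k 2 ∩ PCB.pcbIdeals k 2 =
      {J : Ideal (MvPolynomial (Fin 2) k) | ∃ a b : ℕ, 0 < a ∧ 0 < b ∧
        Irreducible (MvPolynomial.X 0 ^ a - MvPolynomial.X 1 ^ b : MvPolynomial (Fin 2) k) ∧
        J = Ideal.span {MvPolynomial.X 0 ^ a - MvPolynomial.X 1 ^ b}}) ∧
    (∀ a b : ℕ, 0 < a → 0 < b →
      (Irreducible (MvPolynomial.X 0 ^ a - MvPolynomial.X 1 ^ b : MvPolynomial (Fin 2) k) ↔
        Nat.gcd a b = 1)) := by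
  refine ⟨fun n hn => PCB.hostenShapiroIdeals_inter_pcbIdeals_eq_empty hn, ?_, fun a b ha hb =>
    ⟨PCB.gcd_eq_one_of_irreducible ha hb, PCB.irreducible_of_gcd_eq_one ha hb⟩⟩
  ext J
  refine ⟨fun h => PCB.exists_irreducible_of_mem_inter h.1 h.2, ?_⟩
  rintro ⟨a, b, ha, hb, h, rfl⟩
  exact ⟨PCB.span_mem_hostenShapiroIdeals ha hb h, PCB.span_mem_pcbIdeals ha hb⟩
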